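/- A \emph{ribbon graph} $G$ is a (possibly non-orientable, possibly disconnected) compact surface with boundary, written as a union of finitely many discs called vertices and finitely many discs called edges, such that vertices and edges intersect in disjoint line segments (the \emph{common line segments}), each lying on the boundary of exactly one vertex and exactly one edge, and every edge contains exactly two of them. Removing the common line segments from the boundary of a vertex (if there are any) leaves the \emph{vertex line segments} of this vertex; removing the two common line segments from the boundary of an edge leaves its two \emph{edge line segments}. Ribbon graphs are \emph{equivalent} if there is a homeomorphism between them mapping vertices to vertices and edges to edges. In the arrow presentation of $G$, an edge $e$ is recorded by two marking arrows $e',e''$ labelled $e$ on its common line segments, such that its edge line segments join the head of $e'$ to the tail of $e''$ and the head of $e''$ to the tail of $e'$. $G$ is \emph{checkerboard colourable} if its boundary components can be assigned two colours such that the two edge line segments of each edge have different colours. For an edge $e$, the partial dual $G^e$ is obtained by replacing $e',e''$ and the arcs containing them by the segments directed from the head of $e'$ to the tail of $e''$ and from the head of $e''$ to the tail of $e'$, both being marking arrows labelled $e$; the \emph{contraction} of $e$ is $G/e:=G^e-e$, where $-e$ denotes removal of the edge disc $e$. The geometric dual $G^*$ is the partial dual with respect to all edges. \emph{Evenly splitting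 a vertex} means: choose two different vertex line segments of one vertex such that at least one of the two arcs of the vertex boundary between them contains an even number of common line segments, attach a new edge whose two marking arrows lie on these two segments and are consistent with one direction of travel around the vertex boundary, and contract the new edge. A ribbon graph $H$ is a \emph{checkerboard colourable minor} of $G$ if $H$ can be obtained from $G$ by a (possibly empty) sequence of contractions of arbitrary edges, deletions of connected components, and even splittings of vertices. Let $B_1$ be the ribbon graph with one vertex and one edge that is an orientable loop (so $B_1^*$ has two vertices joined by one edge), and $B_{\overline 1}$ the ribbon graph with one vertex and one edge that is a non-orientable loop. \textbf{Theorem.} A ribbon graph is checkerboard colourable if and only if it contains no checkerboard colourable minor equivalent to $B_1^*$ or $B_{\overline 1}$. -/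

import Mathlib

universe u v

/-- A (finite, possibly non-orientable, possibly disconnected) ribbon graph, recorded by its line
segments.  A `Flag` is an end point of a common line segment, that is, the tail or the head of a
marking arrow in the arrow presentation.  Every flag is an end point of exactly one common line
segment, one edge line segment and one vertex line segment; `com`, `edg`, `ver` send a flag
to the other end point of that common, edge, vertex line segment.  The boundary of an edge disc
is a quadrilateral `x, com x, edg (com x), edg x` with four different corners.  A vertex disc that
meets no edge carries no flag; these vertices are listed in `Lone`. -/
structure RibbonGraph where
  Flag : Type u
  Lone : Type u
  finite_flag : Finite Flag
  finite_lone : Finite Lone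
  com : Flag → Flag
  edg : Flag → Flag
  ver : Flag → Flag
  com_com : ∀ x, com (com x) = x
  edg_edg : ∀ x, edg (edg x) = x
  ver_ver : ∀ x, ver (ver x) = x
  com_ne : ∀ x, com x ≠ x
  edg_ne : ∀ x, edg x ≠ x
  ver_ne : ∀ x, ver x ≠ x
  com_edg : ∀ x, com (edg x) = edg (com x)
  com_edg_ne : ∀ x, com (edg x) ≠ x

namespace RibbonGraph

/-- Flags lying on the boundary of the same vertex disc. -/
def vertexSetoid (G : RibbonGraph.{u}) : Setoid G.Flag :=
  Relation.EqvGen.setoid (fun x y => y = G.ver x ∨ y = G.com x)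

/-- Flags lying on the same boundary component of the surface. -/
def boundarySetoid (G : RibbonGraph.{u}) : Setoid G.Flag :=
  Relation.EqvGen.setoid (fun x y => y = G.ver x ∨ y = G.edg x)

/-- Flags lying in the same connected component of the surface. -/
def componentSetoid (G : RibbonGraph.{u}) : Setoid G.Flag :=
  Relation.EqvGen.setoid (fun x y => y = G.ver x ∨ y = G.com x ∨ y = G.edg x)

/-- The boundary components of the ribbon graph (a lone vertex has one). -/
def BoundaryComponent (G : RibbonGraph.{u}) : Type u :=
  Quotient G.boundarySetoid ⊕ G.Lone

/-- The boundary component through the flag `x`; it contains the edge line segment at `x`. -/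
def boundaryAt (G : RibbonGraph.{u}) (x : G.Flag) : G.BoundaryComponent :=
  Sum.inl (Quotient.mk G.boundarySetoid x)

/-- Two colours are assigned to the boundary components such that the two edge line segments
of each edge (the one at `x` and the one at `com x`) get different colours. -/
def CheckerboardColourable (G : RibbonGraph.{u}) : Prop :=
  ∃ colour : G.BoundaryComponent → Bool,
    ∀ x : G.Flag, colour (G.boundaryAt x) ≠ colour (G.boundaryAt (G.com x))

/-- Equivalence of ribbon graphs: a homeomorphism of the surfaces (orientation need not be
respected) that maps vertex discs to vertex discs and edge discs to edge discs. -/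
def Equivalent (G : RibbonGraph.{u}) (H : RibbonGraph.{v}) : Prop :=
  (∃ φ : G.Flag ≃ H.Flag, ∀ x, φ (G.com x) = H.com (φ x) ∧ φ (G.edg x) = H.edg (φ x) ∧
    φ (G.ver x) = H.ver (φ x)) ∧ Nonempty (G.Lone ≃ H.Lone)

/-- The four corners of the edge containing the flag `x`. -/
def edgeOf (G : RibbonGraph.{u}) (x : G.Flag) : Set G.Flag :=
  {x, G.com x, G.edg x, G.com (G.edg x)}

theorem com_mem_edgeOf (G : RibbonGraph.{u}) {x y : G.Flag} (h : y ∈ G.edgeOf x) :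
    G.com y ∈ G.edgeOf x := by
  simp only [edgeOf, Set.mem_insert_iff, Set.mem_singleton_iff] at h ⊢
  rcases h with rfl | rfl | rfl | rfl <;> simp [G.com_com]

theorem edg_mem_edgeOf (G : RibbonGraph.{u}) {x y : G.Flag} (h : y ∈ G.edgeOf x) :
    G.edg y ∈ G.edgeOf x := by
  simp only [edgeOf, Set.mem_insert_iff, Set.mem_singleton_iff] at h ⊢
  rcases h with rfl | rfl | rfl | rfl <;> simp [G.edg_edg, G.com_edg]

theorem com_mem_edgeOf_iff (G : RibbonGraph.{u}) {x y : G.Flag} :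
    G.com y ∈ G.edgeOf x ↔ y ∈ G.edgeOf x :=
  ⟨fun h => by simpa [G.com_com] using G.com_mem_edgeOf h, G.com_mem_edgeOf⟩

theorem edg_mem_edgeOf_iff (G : RibbonGraph.{u}) {x y : G.Flag} :
    G.edg y ∈ G.edgeOf x ↔ y ∈ G.edgeOf x :=
  ⟨fun h => by simpa [G.edg_edg] using G.edg_mem_edgeOf h, G.edg_mem_edgeOf⟩

/-- The geometric dual: vertex boundaries and boundary components are interchanged. -/
def dual (G : RibbonGraph.{u}) : RibbonGraph.{u} where
  Flag := G.Flag
  Lone := G.Lone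
  finite_flag := G.finite_flag
  finite_lone := G.finite_lone
  com := G.edg
  edg := G.com
  ver := G.ver
  com_com := G.edg_edg
  edg_edg := G.com_com
  ver_ver := G.ver_ver
  com_ne := G.edg_ne
  edg_ne := G.com_ne
  ver_ne := G.ver_ne
  com_edg x := (G.com_edg x).symm
  com_edg_ne x := by rw [← G.com_edg]; exact G.com_edg_ne x

open Classical in
/-- The partial dual with respect to the single edge containing `x`: the marking arrows of this
edge are replaced by arrows along its two edge line segments. -/
noncomputable def partialDual (G : RibbonGraph.{u}) (x : G.Flag) : RibbonGraph.{u} where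
  Flag := G.Flag
  Lone := G.Lone
  finite_flag := G.finite_flag
  finite_lone := G.finite_lone
  com y := if y ∈ G.edgeOf x then G.edg y else G.com y
  edg y := if y ∈ G.edgeOf x then G.com y else G.edg y
  ver := G.ver
  com_com y := by
    by_cases h : y ∈ G.edgeOf x <;>
      simp [h, G.com_mem_edgeOf_iff, G.edg_mem_edgeOf_iff, G.com_com, G.edg_edg]
  edg_edg y := by
    by_cases h : y ∈ G.edgeOf x <;>
      simp [h, G.com_mem_edgeOf_iff, G.edg_mem_edgeOf_iff, G.com_com, G.edg_edg]
  ver_ver := G.ver_ver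
  com_ne y := by
    by_cases h : y ∈ G.edgeOf x <;> simp [h, G.com_ne, G.edg_ne]
  edg_ne y := by
    by_cases h : y ∈ G.edgeOf x <;> simp [h, G.com_ne, G.edg_ne]
  ver_ne := G.ver_ne
  com_edg y := by
    by_cases h : y ∈ G.edgeOf x <;>
      simp [h, G.com_mem_edgeOf_iff, G.edg_mem_edgeOf_iff, G.com_edg]
  com_edg_ne y := by
    by_cases h : y ∈ G.edgeOf x
    · simpa [h, G.com_mem_edgeOf_iff, G.com_edg] using G.com_edg_ne y
    · simpa [h, G.edg_mem_edgeOf_iff] using G.com_edg_ne y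

/-- One step along the boundary of a vertex: cross the common line segment at `x`, then run
along the next vertex line segment to its far end.  Thus `x` and `turn x` are the front ends of
two consecutive vertex line segments. -/
def turn (G : RibbonGraph.{u}) (x : G.Flag) : G.Flag := G.ver (G.com x)

open Classical in
/-- The vertex line segments after the edge containing `x` is removed: follow the vertex boundary
from `y`, passing over the (at most two) common line segments of that edge. -/
noncomputable def reroute (G : RibbonGraph.{u}) (x y : G.Flag) : G.Flag :=
  if G.ver y ∈ G.edgeOf x then
    if G.turn (G.ver y) ∈ G.edgeOf x then G.turn (G.turn (G.ver y)) else G.turn (G.ver y)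
  else G.ver y

theorem turn_turn_notMem (G : RibbonGraph.{u}) {x z : G.Flag} (h0 : G.ver z ∉ G.edgeOf x)
    (h1 : z ∈ G.edgeOf x) (h2 : G.turn z ∈ G.edgeOf x) :
    G.turn (G.turn z) ∉ G.edgeOf x := by
  intro h3
  have key : ∀ a b d : G.Flag, a ∈ G.edgeOf x → b ∈ G.edgeOf x → d ∈ G.edgeOf x →
      a = b ∨ a = G.com b ∨ d = a ∨ d = G.com a ∨ d = b ∨ d = G.com b := by
    intro a b d ha hb hd
    simp only [edgeOf, Set.mem_insert_iff, Set.mem_singleton_iff] at ha hb hd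
    rcases ha with rfl | rfl | rfl | rfl <;> rcases hb with rfl | rfl | rfl | rfl <;>
      rcases hd with rfl | rfl | rfl | rfl <;> simp [G.com_com]
  have inj : ∀ p q, G.ver p = q → p = G.ver q := fun p q h => by rw [← h, G.ver_ver]
  rcases key _ _ _ h2 h1 h3 with h | h | h | h | h | h
  · have := inj _ _ h
    exact h0 (this ▸ G.com_mem_edgeOf h1)
  · exact G.ver_ne _ h
  · have := inj _ _ h
    simp only [turn, G.ver_ver] at this
    have h' : G.ver (G.com z) = z := by
      rw [← G.com_com (G.ver (G.com z)), this, G.com_com]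
    exact h0 (inj _ _ h' ▸ G.com_mem_edgeOf h1)
  · exact G.ver_ne _ h
  · exact h0 (inj _ _ h ▸ G.com_mem_edgeOf h2)
  · have := inj _ _ h
    exact G.com_ne _ this

theorem reroute_notMem (G : RibbonGraph.{u}) {x y : G.Flag} (hy : y ∉ G.edgeOf x) :
    G.reroute x y ∉ G.edgeOf x := by
  unfold reroute
  split_ifs with h1 h2
  · exact G.turn_turn_notMem (by rwa [G.ver_ver]) h1 h2
  · exact h2
  · exact h1

theorem reroute_reroute (G : RibbonGraph.{u}) {x y : G.Flag} (hy : y ∉ G.edgeOf x) :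
    G.reroute x (G.reroute x y) = y := by
  by_cases h1 : G.ver y ∈ G.edgeOf x
  · by_cases h2 : G.turn (G.ver y) ∈ G.edgeOf x
    · have h2' : G.ver (G.com (G.ver y)) ∈ G.edgeOf x := h2
      simp [reroute, turn, h1, h2', G.ver_ver, G.com_com, G.com_mem_edgeOf_iff]
    · have h2' : G.ver (G.com (G.ver y)) ∉ G.edgeOf x := h2
      simp [reroute, turn, h1, h2', hy, G.ver_ver, G.com_com, G.com_mem_edgeOf_iff]
  · simp [reroute, h1, hy, G.ver_ver]

theorem reroute_ne (G : RibbonGraph.{u}) (x y : G.Flag) : G.reroute x y ≠ y := by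
  have inj : ∀ p q, G.ver p = q → p = G.ver q := fun p q h => by rw [← h, G.ver_ver]
  unfold reroute
  split_ifs with h1 h2
  · intro h
    have h' := congrArg G.com (inj _ _ h)
    rw [G.com_com] at h'
    exact G.ver_ne _ h'
  · exact fun h => G.com_ne _ (inj _ _ h)
  · exact G.ver_ne y

/-- Deletion of the edge containing `x`.  The vertices all of whose marking arrows belong to
this edge become lone vertices. -/
noncomputable def delete (G : RibbonGraph.{u}) (x : G.Flag) : RibbonGraph.{u} where
  Flag := {y : G.Flag // y ∉ G.edgeOf x}
  Lone := G.Lone ⊕ {o : Quotient G.vertexSetoid //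
    ∀ y : G.Flag, Quotient.mk G.vertexSetoid y = o → y ∈ G.edgeOf x}
  finite_flag := by
    have := G.finite_flag
    infer_instance
  finite_lone := by
    have := G.finite_flag
    have := G.finite_lone
    infer_instance
  com y := ⟨G.com y.1, fun h => y.2 (G.com_mem_edgeOf_iff.1 h)⟩
  edg y := ⟨G.edg y.1, fun h => y.2 (G.edg_mem_edgeOf_iff.1 h)⟩
  ver y := ⟨G.reroute x y.1, G.reroute_notMem y.2⟩
  com_com y := Subtype.ext (G.com_com y.1)
  edg_edg y := Subtype.ext (G.edg_edg y.1)
  ver_ver y := Subtype.ext (G.reroute_reroute y.2)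
  com_ne y h := G.com_ne y.1 (congrArg Subtype.val h)
  edg_ne y h := G.edg_ne y.1 (congrArg Subtype.val h)
  ver_ne y h := G.reroute_ne x y.1 (congrArg Subtype.val h)
  com_edg y := Subtype.ext (G.com_edg y.1)
  com_edg_ne y h := G.com_edg_ne y.1 (congrArg Subtype.val h)

/-- Contraction of the edge `e` containing `x`: the ribbon graph `G^e - e`. -/
noncomputable def contract (G : RibbonGraph.{u}) (x : G.Flag) : RibbonGraph.{u} :=
  (G.partialDual x).delete x

/-- Deletion of the connected component containing `x`. -/
def deleteComponentAt (G : RibbonGraph.{u}) (x : G.Flag) : RibbonGraph.{u} where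
  Flag := {y : G.Flag // ¬ G.componentSetoid y x}
  Lone := G.Lone
  finite_flag := by
    have := G.finite_flag
    infer_instance
  finite_lone := G.finite_lone
  com y := ⟨G.com y.1, fun h => y.2
    (G.componentSetoid.trans (Relation.EqvGen.rel _ _ (Or.inr (Or.inl rfl))) h)⟩
  edg y := ⟨G.edg y.1, fun h => y.2
    (G.componentSetoid.trans (Relation.EqvGen.rel _ _ (Or.inr (Or.inr rfl))) h)⟩
  ver y := ⟨G.ver y.1, fun h => y.2
    (G.componentSetoid.trans (Relation.EqvGen.rel _ _ (Or.inl rfl)) h)⟩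
  com_com y := Subtype.ext (G.com_com y.1)
  edg_edg y := Subtype.ext (G.edg_edg y.1)
  ver_ver y := Subtype.ext (G.ver_ver y.1)
  com_ne y h := G.com_ne y.1 (congrArg Subtype.val h)
  edg_ne y h := G.edg_ne y.1 (congrArg Subtype.val h)
  ver_ne y h := G.ver_ne y.1 (congrArg Subtype.val h)
  com_edg y := Subtype.ext (G.com_edg y.1)
  com_edg_ne y h := G.com_edg_ne y.1 (congrArg Subtype.val h)

/-- Deletion of a connected component that consists of a lone vertex. -/
def deleteLone (G : RibbonGraph.{u}) (i : G.Lone) : RibbonGraph.{u} :=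
  { G with
    Lone := {j : G.Lone // j ≠ i}
    finite_lone := by
      have := G.finite_lone
      infer_instance }

open Classical in
/-- A new edge is attached.  Its two marking arrows are `false` and `true`, and
the flags `Sum.inr (i, false)` and `Sum.inr (i, true)` are the tail and the head of arrow `i`.
Arrow `false` is put on the vertex line segment with end points `ver a`, `a`, pointing from
`ver a` to `a`; arrow `true` is put on the vertex line segment with end points `ver b`, `b`,
pointing from `ver b` to `b`.  The edge line segments of the new edge join the head
of each arrow to the tail of the other. -/
noncomputable def insertEdge (G : RibbonGraph.{u}) (a b : G.Flag) (hab : b ≠ a)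
    (hab' : b ≠ G.ver a) : RibbonGraph.{u} where
  Flag := G.Flag ⊕ (Bool × Bool)
  Lone := G.Lone
  finite_flag := by
    have := G.finite_flag
    infer_instance
  finite_lone := G.finite_lone
  com := Sum.map G.com (fun p => (p.1, !p.2))
  edg := Sum.map G.edg (fun p => (!p.1, !p.2))
  ver := Sum.elim
    (fun y =>
      if y = G.ver a then Sum.inr (false, false)
      else if y = a then Sum.inr (false, true)
      else if y = G.ver b then Sum.inr (true, false)
      else if y = b then Sum.inr (true, true)
      else Sum.inl (G.ver y))
    (fun p => Sum.inl
      (if p.1 then (if p.2 then b else G.ver b) else (if p.2 then a else G.ver a)))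
  com_com y := by rcases y with y | ⟨i, j⟩ <;> simp [G.com_com]
  edg_edg y := by rcases y with y | ⟨i, j⟩ <;> simp [G.edg_edg]
  ver_ver y := by
    have inj : ∀ p q, G.ver p = q ↔ p = G.ver q := fun p q =>
      ⟨fun h => by rw [← h, G.ver_ver], fun h => by rw [h, G.ver_ver]⟩
    rcases y with y | ⟨i, j⟩
    · simp only [Sum.elim_inl]
      split_ifs with h1 h2 h3 h4 <;> simp [*, G.ver_ver]
    · have e1 : a ≠ G.ver a := (G.ver_ne a).symm
      have e2 : b ≠ G.ver b := (G.ver_ne b).symm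
      have e3 : G.ver b ≠ a := fun h => hab' ((inj _ _).1 h)
      have e4 : G.ver b ≠ G.ver a := fun h => hab (by rw [← G.ver_ver b, h, G.ver_ver])
      cases i <;> cases j <;> simp [hab, hab', e1, e2, e3, e4]
  com_ne y := by rcases y with y | ⟨i, j⟩ <;> simp [G.com_ne]
  edg_ne y := by rcases y with y | ⟨i, j⟩ <;> simp [G.edg_ne]
  ver_ne y := by
    rcases y with y | ⟨i, j⟩
    · simp only [Sum.elim_inl]
      split_ifs <;> simp [G.ver_ne]
    · simp
  com_edg y := by rcases y with y | ⟨i, j⟩ <;> simp [G.com_edg]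
  com_edg_ne y := by rcases y with y | ⟨i, j⟩ <;> simp [G.com_edg_ne]

/-- The vertex line segments with front ends `a` and `b` lie on the same vertex boundary, and one
travels from the first to the second over an even number `k` of common line segments.
Here `Function.minimalPeriod G.turn a` is the number of all vertex line segments (and of all
common line segments) of this vertex boundary; exchanging `a` and `b` gives the other arc. -/
def EvenArc (G : RibbonGraph.{u}) (a b : G.Flag) : Prop :=
  ∃ k < Function.minimalPeriod G.turn a, Even k ∧ G.turn^[k] a = b

/-- Evenly splitting a vertex: choose two different vertex line segments of the vertex such that
an arc of the vertex boundary between them contains an even number of common line segments, attach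
a new edge at them whose marking arrows are consistent on the vertex boundary, and contract
the new edge. -/
noncomputable def evenSplit (G : RibbonGraph.{u}) (a b : G.Flag) (hab : b ≠ a)
    (hab' : b ≠ G.ver a) (_h : G.EvenArc a b) : RibbonGraph.{u} :=
  (G.insertEdge a b hab hab').contract (Sum.inr (false, false))

/-- A single edge contraction, component deletion, or even splitting of a vertex. -/
inductive MinorStep : RibbonGraph.{u} → RibbonGraph.{u} → Prop
  | contract (G : RibbonGraph.{u}) (x : G.Flag) : MinorStep G (G.contract x)
  | deleteComponentAt (G : RibbonGraph.{u}) (x : G.Flag) : MinorStep G (G.deleteComponentAt x)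
  | deleteLone (G : RibbonGraph.{u}) (i : G.Lone) : MinorStep G (G.deleteLone i)
  | evenSplit (G : RibbonGraph.{u}) (a b : G.Flag) (hab : b ≠ a) (hab' : b ≠ G.ver a)
      (h : G.EvenArc a b) : MinorStep G (G.evenSplit a b hab hab' h)

/-- `H` is a checkerboard colourable minor of `G`. -/
def IsCheckerboardColourableMinor (H G : RibbonGraph.{u}) : Prop :=
  Relation.ReflTransGen MinorStep G H

/-- The bouquet with one orientable loop: the flags `(i, false)`, `(i, true)` are the tail
and the head of arrow `i`; around the vertex one meets tail, head, tail, head. -/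
def B₁ : RibbonGraph.{0} where
  Flag := Bool × Bool
  Lone := Empty
  finite_flag := inferInstance
  finite_lone := inferInstance
  com p := (p.1, !p.2)
  edg p := (!p.1, !p.2)
  ver p := (!p.1, !p.2)
  com_com := by decide
  edg_edg := by decide
  ver_ver := by decide
  com_ne := by decide
  edg_ne := by decide
  ver_ne := by decide
  com_edg := by decide
  com_edg_ne := by decide

/-- The bouquet with one non-orientable loop: around the vertex one meets tail, head, head,
tail. -/
def Bbar₁ : RibbonGraph.{0} where
  Flag := Bool × Bool
  Lone := Empty
  finite_flag := inferInstance
  finite_lone := inferInstance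
  com p := (p.1, !p.2)
  edg p := (!p.1, !p.2)
  ver p := (!p.1, p.2)
  com_com := by decide
  edg_edg := by decide
  ver_ver := by decide
  com_ne := by decide
  edg_ne := by decide
  ver_ne := by decide
  com_edg := by decide
  com_edg_ne := by decide

end RibbonGraph

/-! A colouring is a function on flags that is constant along boundary components
(`BoundaryInvariant`) and changes under `com`. Contracting an edge keeps such constancy and only
drops the condition at that edge (`checkerboardColourable_contract_iff`). Hence colourability passes
to minors: colours alternate along a vertex boundary, so an even splitting joins two segments of one
colour. The two excluded graphs are not colourable, since in each both sides of the edge lie on one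
boundary component.

Conversely, a non-colourable graph is reduced by strong induction on the number of flags. Suppose a
vertex line segment joins corners `y` and `ver y` of different edges. These edges share a boundary
component on the near side. If they also share one on the far side, then properness at one forces
properness at the other, so contracting the edge of `y` keeps the graph non-colourable
(`of_contract`). If not, an even splitting across the two edges first forces equal colours on the
far sides (`of_contract_evenSplit`). If no such segment exists, every edge forms its own component;
one of these is an excluded graph, and the other edges are contracted and the lone vertices deleted.
-/

namespace RibbonGraph

/-! ### Colourings as functions on flags -/

/-- A function on flags that is constant along boundary components. -/
def BoundaryInvariant (G : RibbonGraph.{u}) (c : G.Flag → Bool) : Prop :=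
  (∀ w, c (G.ver w) = c w) ∧ ∀ w, c (G.edg w) = c w

/-- Lone vertices meet no edge, so their colour is free and only the colours of flags matter. -/
theorem checkerboardColourable_iff (G : RibbonGraph.{u}) :
    G.CheckerboardColourable ↔
      ∃ c : G.Flag → Bool, G.BoundaryInvariant c ∧ ∀ w, c w ≠ c (G.com w) := by
  constructor
  · rintro ⟨c, hc⟩
    refine ⟨fun w => c (G.boundaryAt w), ⟨fun w => ?_, fun w => ?_⟩, hc⟩ <;>
      refine congrArg c (congrArg Sum.inl (Quotient.sound (G.boundarySetoid.symm ?_)))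
    · exact Relation.EqvGen.rel _ _ (Or.inl rfl)
    · exact Relation.EqvGen.rel _ _ (Or.inr rfl)
  · rintro ⟨c, ⟨hv, he⟩, hc⟩
    refine ⟨Sum.elim (Quotient.lift c ?_) fun _ => true, hc⟩
    intro p q h
    induction h with
    | rel p q h => rcases h with rfl | rfl <;> simp [hv, he]
    | refl => rfl
    | symm _ _ _ ih => exact ih.symm
    | trans _ _ _ _ _ ih ih' => exact ih.trans ih'

/-! ### Colourings of a contraction -/

theorem self_mem_edgeOf (G : RibbonGraph.{u}) (x : G.Flag) : x ∈ G.edgeOf x := by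
  simp [edgeOf]

theorem ver_injective (G : RibbonGraph.{u}) : Function.Injective G.ver :=
  Function.LeftInverse.injective G.ver_ver

theorem com_injective (G : RibbonGraph.{u}) : Function.Injective G.com :=
  Function.LeftInverse.injective G.com_com

theorem mem_edgeOf_comm (G : RibbonGraph.{u}) {x y : G.Flag} (h : y ∈ G.edgeOf x) :
    x ∈ G.edgeOf y := by
  simp only [edgeOf, Set.mem_insert_iff, Set.mem_singleton_iff] at h ⊢
  rcases h with rfl | rfl | rfl | rfl <;> simp [G.com_com, G.edg_edg, G.com_edg]

/-- The partial dual swaps `com` and `edg` on these four corners, which permutes them. Membership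
conditions in `G^e - e` can therefore be read in `G`. -/
theorem edgeOf_partialDual (G : RibbonGraph.{u}) (x : G.Flag) :
    (G.partialDual x).edgeOf x = G.edgeOf x := by
  have hx := G.self_mem_edgeOf x
  have hc := G.com_mem_edgeOf hx
  have h1 : (G.partialDual x).com x = G.edg x := if_pos hx
  have h2 : (G.partialDual x).edg x = G.com x := if_pos hx
  have h3 : (G.partialDual x).com (G.com x) = G.edg (G.com x) := if_pos hc
  refine Set.ext fun w => ?_
  change w = x ∨ w = (G.partialDual x).com x ∨ w = (G.partialDual x).edg x ∨
    w = (G.partialDual x).com ((G.partialDual x).edg x) ↔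
    w = x ∨ w = G.com x ∨ w = G.edg x ∨ w = G.com (G.edg x)
  rw [h1, h2, h3, G.com_edg]
  tauto

/-- Walking in from the outside flag `turn w` and through `w`, `ver w`, one passes over two common
line segments of the edge. It has no third, so the walk then leaves it. -/
theorem turn_ver_notMem (G : RibbonGraph.{u}) {x w : G.Flag} (hw : w ∈ G.edgeOf x)
    (hv : G.ver w ∈ G.edgeOf x) (ht : G.turn w ∉ G.edgeOf x) :
    G.turn (G.ver w) ∉ G.edgeOf x := by
  have h : G.turn (G.com w) = G.ver w := by simp [turn, G.com_com]
  rw [← h]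
  exact G.turn_turn_notMem ht (G.com_mem_edgeOf hw) (by rwa [h])

/-- A function that is constant along the vertices of `G - e` extends to a function that is
constant along the vertices of `G`. -/
theorem exists_extend_delete (G : RibbonGraph.{u}) (x : G.Flag) (c : (G.delete x).Flag → Bool)
    (hc : ∀ w, c ((G.delete x).ver w) = c w) :
    ∃ d : G.Flag → Bool, (∀ w, d (G.ver w) = d w) ∧
      (∀ w ∈ G.edgeOf x, d (G.com w) = d w) ∧ ∀ w : (G.delete x).Flag, d w.1 = c w := by
  classical
  let c' : G.Flag → Bool := fun w => if h : w ∉ G.edgeOf x then c ⟨w, h⟩ else false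
  have hc' : ∀ w, w ∉ G.edgeOf x → c' (G.reroute x w) = c' w := fun w h => by
    simp only [c', dif_pos h, dif_pos (G.reroute_notMem h)]
    exact hc ⟨w, h⟩
  have turn_com : ∀ w, G.turn (G.com w) = G.ver w := fun w => by simp [turn, G.com_com]
  have ver_com : ∀ w, G.ver (G.com w) = G.turn w := fun w => rfl
  have ver_turn : ∀ w, G.ver (G.turn w) = G.com w := fun w => by simp [turn, G.ver_ver]
  -- A corner of `e` takes the colour of an outside flag that ends the stretch of vertex boundary
  -- replaced by `reroute`: across its vertex line segment if possible, otherwise across its common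
  -- line segment. If neither works, the vertex meets no other edge and any constant, here `false`,
  -- will do.
  let d : G.Flag → Bool := fun w =>
    if w ∉ G.edgeOf x then c' w else if G.ver w ∉ G.edgeOf x then c' (G.ver w) else
      if G.turn w ∉ G.edgeOf x then c' (G.turn w) else false
  refine ⟨d, fun w => ?_, fun w hw => ?_, fun w => ?_⟩
  · by_cases hw : w ∈ G.edgeOf x <;> by_cases hv : G.ver w ∈ G.edgeOf x
    · by_cases ht : G.turn w ∈ G.edgeOf x
      · have ht' : G.turn (G.ver w) ∈ G.edgeOf x := by
          by_contra h
          exact G.turn_ver_notMem hv (by rwa [G.ver_ver]) h (by rwa [G.ver_ver])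
        simp [d, hw, hv, ht, ht', G.ver_ver]
      · have ht' := G.turn_ver_notMem hw hv ht
        have := hc' _ ht
        simp only [reroute, ver_turn, G.com_mem_edgeOf_iff, hw, turn_com, hv, if_true] at this
        simp [d, hw, hv, ht, ht', G.ver_ver, this]
    · simp [d, hw, hv]
    · simp [d, hw, hv, G.ver_ver]
    · have := hc' _ hw
      simp only [reroute, hv, if_false] at this
      simp [d, hw, hv, this]
  · by_cases hv : G.ver w ∈ G.edgeOf x <;> by_cases ht : G.turn w ∈ G.edgeOf x
    · simp [d, G.com_mem_edgeOf_iff, hw, hv, ht, ver_com, turn_com]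
    · simp [d, G.com_mem_edgeOf_iff, hw, hv, ht, ver_com]
    · simp [d, G.com_mem_edgeOf_iff, hw, hv, ht, ver_com, turn_com]
    · have := hc' _ hv
      simp only [reroute, G.ver_ver, hw, ht, if_true, if_false] at this
      simp [d, G.com_mem_edgeOf_iff, hw, hv, ht, ver_com, this]
  · have hw : w.1 ∉ G.edgeOf x := w.2
    simp only [d, c', if_pos hw, dif_pos hw]
    rfl

/-- The common line segments of `e` in `G^e` are its edge line segments in `G`, so constancy across
them is invariance under `edg` at `e`. -/
theorem BoundaryInvariant.exists_extend_contract {G : RibbonGraph.{u}} {x : G.Flag}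
    {c : (G.contract x).Flag → Bool} (hc : (G.contract x).BoundaryInvariant c) :
    ∃ d : G.Flag → Bool, G.BoundaryInvariant d ∧ ∀ w : (G.contract x).Flag, d w.1 = c w := by
  obtain ⟨d, hv, he, hd⟩ := (G.partialDual x).exists_extend_delete x c hc.1
  refine ⟨d, ⟨hv, fun w => ?_⟩, hd⟩
  by_cases hw : w ∈ G.edgeOf x
  · have h : (G.partialDual x).com w = G.edg w := if_pos hw
    rw [← h]
    exact he w (by rwa [edgeOf_partialDual])
  · have h : (G.partialDual x).edg w = G.edg w := if_neg hw
    have hw' : w ∉ (G.partialDual x).edgeOf x := by rwa [edgeOf_partialDual]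
    rw [← h]
    exact (hd _).trans ((hc.2 ⟨w, hw'⟩).trans (hd _).symm)

/-- A rerouted segment is made of vertex line segments and of edge line segments of `e`, so it stays
on one boundary component of `G`. -/
theorem BoundaryInvariant.restrict_contract {G : RibbonGraph.{u}} {c : G.Flag → Bool}
    (hc : G.BoundaryInvariant c) (x : G.Flag) :
    (G.contract x).BoundaryInvariant fun w => c w.1 := by
  have hcom : ∀ w ∈ (G.partialDual x).edgeOf x, c ((G.partialDual x).com w) = c w := by
    intro w hw
    rw [edgeOf_partialDual] at hw
    have h : (G.partialDual x).com w = G.edg w := if_pos hw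
    exact (congrArg c h).trans (hc.2 w)
  have hver : ∀ w, c ((G.partialDual x).ver w) = c w := hc.1
  refine ⟨fun w => ?_, fun w => ?_⟩
  · change c ((G.partialDual x).reroute x w.1) = c w.1
    unfold reroute
    split_ifs with h1 h2
    · rw [turn, hver, hcom _ h2, turn, hver, hcom _ h1, hver]
    · rw [turn, hver, hcom _ h1, hver]
    · exact hver _
  · have hw : w.1 ∉ G.edgeOf x := by
      rw [← edgeOf_partialDual]
      exact w.2
    have h : (G.partialDual x).edg w.1 = G.edg w.1 := if_neg hw
    exact (congrArg c h).trans (hc.2 _)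

theorem com_contract (G : RibbonGraph.{u}) (x : G.Flag) (w : (G.contract x).Flag) :
    ((G.contract x).com w).1 = G.com w.1 := by
  have hw : w.1 ∉ G.edgeOf x := by
    rw [← edgeOf_partialDual]
    exact w.2
  exact if_neg hw

/-- The colourings of `G / e` are the assignments of colours to the boundary components of `G`
that are proper at all edges except possibly `e`. -/
theorem checkerboardColourable_contract_iff (G : RibbonGraph.{u}) (x : G.Flag) :
    (G.contract x).CheckerboardColourable ↔
      ∃ c : G.Flag → Bool, G.BoundaryInvariant c ∧
        ∀ w, w ∉ G.edgeOf x → c w ≠ c (G.com w) := by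
  rw [checkerboardColourable_iff]
  constructor
  · rintro ⟨c, hc, hcom⟩
    obtain ⟨d, hd, hdc⟩ := hc.exists_extend_contract
    refine ⟨d, hd, fun w hw => ?_⟩
    have hw' : w ∉ (G.partialDual x).edgeOf x := by rwa [edgeOf_partialDual]
    have h1 : d w = c ⟨w, hw'⟩ := hdc ⟨w, hw'⟩
    have h2 := hdc ((G.contract x).com ⟨w, hw'⟩)
    exact fun h => hcom ⟨w, hw'⟩ (h1.symm.trans
      (h.trans ((congrArg d (G.com_contract x ⟨w, hw'⟩)).symm.trans h2)))
  · rintro ⟨c, hc, hcom⟩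
    refine ⟨_, hc.restrict_contract x, fun w => ?_⟩
    rw [com_contract]
    refine hcom _ ?_
    rw [← edgeOf_partialDual]
    exact w.2

/-! ### Colourability passes to minors -/

theorem edgeOf_insertEdge (G : RibbonGraph.{u}) (a b : G.Flag) (hab : b ≠ a)
    (hab' : b ≠ G.ver a) :
    (G.insertEdge a b hab hab').edgeOf (Sum.inr (false, false)) = Set.range Sum.inr := by
  refine Set.ext fun w => ?_
  change w = Sum.inr (false, false) ∨ w = Sum.inr (false, true) ∨ w = Sum.inr (true, true) ∨
    w = Sum.inr (true, false) ↔ ∃ p, Sum.inr p = w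
  rcases w with w | ⟨i, j⟩
  · simp
  · refine iff_of_true ?_ ⟨_, rfl⟩
    cases i <;> cases j
    exacts [Or.inl rfl, Or.inr (Or.inl rfl), Or.inr (Or.inr (Or.inr rfl)),
      Or.inr (Or.inr (Or.inl rfl))]

/-- The colour flips at each common line segment of a vertex boundary, so `a` and `b` get the same
colour. Giving that colour to the whole new edge is improper only there, and this edge is
contracted. -/
theorem CheckerboardColourable.evenSplit {G : RibbonGraph.{u}} (hG : G.CheckerboardColourable)
    (a b : G.Flag) (hab : b ≠ a) (hab' : b ≠ G.ver a) (h : G.EvenArc a b) :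
    (G.evenSplit a b hab hab' h).CheckerboardColourable := by
  obtain ⟨c, ⟨hv, he⟩, hc⟩ := (checkerboardColourable_iff G).1 hG
  have hturn : ∀ w, c (G.turn w) = !c w := fun w => by
    have := hc w
    rw [turn, hv]
    cases h1 : c w <;> cases h2 : c (G.com w) <;> simp_all
  have hcab : c b = c a := by
    obtain ⟨k, -, ⟨m, rfl⟩, rfl⟩ := h
    have : ∀ m, c (G.turn^[m + m] a) = c a := by
      intro m
      induction m with
      | zero => rfl
      | succ m ih =>
        rw [show m + 1 + (m + 1) = (m + m) + 1 + 1 by omega, Function.iterate_succ_apply',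
          Function.iterate_succ_apply', hturn, hturn, ih, Bool.not_not]
    exact this m
  refine (checkerboardColourable_contract_iff _ _).2
    ⟨Sum.elim c fun _ => c a, ⟨fun w => ?_, fun w => ?_⟩, fun w hw => ?_⟩
  · rcases w with w | ⟨i, j⟩
    · simp only [insertEdge, Sum.elim_inl]
      split_ifs with h1 h2 h3 h4 <;> simp [*]
    · cases i <;> cases j <;> simp [insertEdge, hv, hcab]
  · rcases w with w | p <;> simp [insertEdge, he]
  · rcases w with w | p
    · exact hc w
    · rw [edgeOf_insertEdge] at hw
      exact (hw ⟨p, rfl⟩).elim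

theorem CheckerboardColourable.of_minorStep {G H : RibbonGraph.{u}} (h : MinorStep G H)
    (hG : G.CheckerboardColourable) : H.CheckerboardColourable := by
  cases h with
  | contract x =>
    obtain ⟨c, hc, hcom⟩ := (checkerboardColourable_iff G).1 hG
    exact (checkerboardColourable_contract_iff G x).2 ⟨c, hc, fun w _ => hcom w⟩
  | deleteComponentAt x =>
    obtain ⟨c, hc, hcom⟩ := (checkerboardColourable_iff G).1 hG
    exact (checkerboardColourable_iff _).2
      ⟨fun w => c w.1, ⟨fun w => hc.1 w.1, fun w => hc.2 w.1⟩, fun w => hcom w.1⟩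
  | deleteLone i =>
    obtain ⟨c, hc, hcom⟩ := (checkerboardColourable_iff G).1 hG
    exact (checkerboardColourable_iff _).2 ⟨c, hc, hcom⟩
  | evenSplit a b hab hab' h => exact hG.evenSplit a b hab hab' h

theorem CheckerboardColourable.of_minor {G H : RibbonGraph.{u}}
    (hG : G.CheckerboardColourable) (h : H.IsCheckerboardColourableMinor G) :
    H.CheckerboardColourable := by
  induction h with
  | refl => exact hG
  | tail _ h ih => exact ih.of_minorStep h

theorem CheckerboardColourable.of_equivalent {G : RibbonGraph.{u}} {H : RibbonGraph.{v}}
    (hG : G.CheckerboardColourable) (h : G.Equivalent H) : H.CheckerboardColourable := by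
  obtain ⟨c, hc, hcom⟩ := (checkerboardColourable_iff G).1 hG
  obtain ⟨⟨φ, hφ⟩, -⟩ := h
  have symm_apply : ∀ (f : G.Flag → G.Flag) (g : H.Flag → H.Flag), (∀ x, φ (f x) = g (φ x)) →
      ∀ w, φ.symm (g w) = f (φ.symm w) := fun f g hfg w => by
    rw [Equiv.symm_apply_eq, hfg, Equiv.apply_symm_apply]
  have h1 := symm_apply _ _ fun x => (hφ x).1
  have h2 := symm_apply _ _ fun x => (hφ x).2.1
  have h3 := symm_apply _ _ fun x => (hφ x).2.2
  refine (checkerboardColourable_iff H).2 ⟨fun w => c (φ.symm w), ⟨?_, ?_⟩, ?_⟩ <;> intro w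
  · exact (congrArg c (h3 w)).trans (hc.1 _)
  · exact (congrArg c (h2 w)).trans (hc.2 _)
  · exact fun h => hcom _ (h.trans (congrArg c (h1 w)))

/-! ### The excluded graphs are not colourable -/

/-- A flag `y` whose vertex line segment forces the two edge line segments of its edge onto one
boundary component. -/
def IsBad (G : RibbonGraph.{u}) (y : G.Flag) : Prop :=
  G.ver y = G.com y ∨ G.ver y = G.com (G.edg y)

theorem IsBad.apply_com {G : RibbonGraph.{u}} {y : G.Flag} (h : G.IsBad y) {c : G.Flag → Bool}
    (hc : G.BoundaryInvariant c) : c (G.com y) = c y := by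
  rcases h with h | h
  · rw [← h, hc.1]
  · rw [← hc.2, ← G.com_edg, ← h, hc.1]

theorem IsBad.not_checkerboardColourable {G : RibbonGraph.{u}} {y : G.Flag} (h : G.IsBad y) :
    ¬ G.CheckerboardColourable := by
  rw [checkerboardColourable_iff]
  rintro ⟨c, hc, hcom⟩
  exact hcom y (h.apply_com hc).symm

theorem not_checkerboardColourable_dual_B₁ : ¬ B₁.dual.CheckerboardColourable :=
  IsBad.not_checkerboardColourable (y := (false, false)) (Or.inl rfl)

theorem not_checkerboardColourable_Bbar₁ : ¬ Bbar₁.CheckerboardColourable :=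
  IsBad.not_checkerboardColourable (y := (false, false)) (Or.inr rfl)

/-! ### Counting flags -/

theorem card_contract (G : RibbonGraph.{u}) (x : G.Flag) :
    Nat.card (G.contract x).Flag + 4 = Nat.card G.Flag := by
  have := G.finite_flag
  have h1 : x ≠ G.com x := (G.com_ne x).symm
  have h2 : x ≠ G.edg x := (G.edg_ne x).symm
  have h3 : x ≠ G.com (G.edg x) := (G.com_edg_ne x).symm
  have h4 : G.com x ≠ G.edg x := fun h => G.com_edg_ne x (by rw [← h, G.com_com])
  have h5 : G.com x ≠ G.com (G.edg x) := fun h => h2 (G.com_injective h)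
  have h6 : G.edg x ≠ G.com (G.edg x) := (G.com_ne _).symm
  have hcard : (G.edgeOf x).ncard = 4 := by
    unfold edgeOf
    rw [Set.ncard_insert_of_notMem (by simp [h1, h2, h3]),
      Set.ncard_insert_of_notMem (by simp [h4, h5]), Set.ncard_pair h6]
  have := Set.ncard_add_ncard_compl (G.edgeOf x)
  have hF : Nat.card (G.contract x).Flag = ((G.edgeOf x)ᶜ).ncard := by
    rw [← edgeOf_partialDual]
    rfl
  omega

/-- The new edge brings four flags and its contraction removes them, so a splitting followed by a
contraction still lowers the count. -/
theorem card_evenSplit (G : RibbonGraph.{u}) (a b : G.Flag) (hab : b ≠ a)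
    (hab' : b ≠ G.ver a) (h : G.EvenArc a b) :
    Nat.card (G.evenSplit a b hab hab' h).Flag = Nat.card G.Flag := by
  have := G.finite_flag
  have h1 := (G.insertEdge a b hab hab').card_contract (Sum.inr (false, false))
  have h2 : Nat.card (G.insertEdge a b hab hab').Flag = Nat.card G.Flag + 4 := by
    change Nat.card (G.Flag ⊕ (Bool × Bool)) = _
    rw [Nat.card_sum]
    simp
  unfold evenSplit
  omega

/-! ### Reduction at a vertex line segment between two edges -/

/-- If only one vertex line segment of a boundary component might join different colours, it
does not. -/
theorem apply_ver_eq_true (G : RibbonGraph.{u}) (d : G.Flag → Bool) (a : G.Flag)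
    (he : ∀ w, d (G.edg w) = d w)
    (hv : ∀ w, G.boundarySetoid a w → w ≠ a → w ≠ G.ver a → d (G.ver w) = d w)
    (ha : d a = true) : d (G.ver a) = true := by
  classical
  have := G.finite_flag
  have := Fintype.ofFinite G.Flag
  by_contra hva
  have stepv : ∀ w, G.boundarySetoid a w → G.boundarySetoid a (G.ver w) := fun w h =>
    G.boundarySetoid.trans h (Relation.EqvGen.rel _ _ (Or.inl rfl))
  have stepe : ∀ w, G.boundarySetoid a w → G.boundarySetoid a (G.edg w) := fun w h =>
    G.boundarySetoid.trans h (Relation.EqvGen.rel _ _ (Or.inr rfl))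
  -- Parity count of the flags coloured `true` on the boundary component of `a`: `edg` pairs them
  -- off, so their number is even.
  let S : Finset G.Flag := Finset.univ.filter fun w => G.boundarySetoid a w ∧ d w = true
  have haS : a ∈ S := by simp [S, ha]
  have h1 : ∑ _w ∈ S, (1 : ZMod 2) = 0 :=
    Finset.sum_involution (fun w _ => G.edg w) (fun _ _ => by decide)
      (fun w _ _ => G.edg_ne w)
      (fun w hw => by
        simp only [S, Finset.mem_filter, Finset.mem_univ, true_and] at hw ⊢
        exact ⟨stepe w hw.1, by rw [he, hw.2]⟩)
      (fun w _ => G.edg_edg w)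
  -- As `ver a` is not coloured `true`, `ver` pairs off all of `S` except `a`, which makes the
  -- number odd.
  have h2 : ∑ _w ∈ S.erase a, (1 : ZMod 2) = 0 :=
    Finset.sum_involution (fun w _ => G.ver w) (fun _ _ => by decide)
      (fun w _ _ => G.ver_ne w)
      (fun w hw => by
        simp only [S, Finset.mem_erase, Finset.mem_filter, Finset.mem_univ, true_and] at hw ⊢
        have hwa : w ≠ G.ver a := by
          rintro rfl
          exact hva hw.2.2
        refine ⟨fun h => hwa ?_, stepv w hw.2.1, by rw [hv w hw.2.1 hw.1 hwa, hw.2.2]⟩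
        rw [← h, G.ver_ver])
      (fun w _ => G.ver_ver w)
  rw [← Finset.sum_erase_add _ _ haS, h2] at h1
  exact absurd h1 (by decide)

theorem apply_ver_eq (G : RibbonGraph.{u}) (d : G.Flag → Bool) (a : G.Flag)
    (he : ∀ w, d (G.edg w) = d w)
    (hv : ∀ w, G.boundarySetoid a w → w ≠ a → w ≠ G.ver a → d (G.ver w) = d w) :
    d (G.ver a) = d a := by
  have h1 := G.apply_ver_eq_true d a he hv
  have h2 := G.apply_ver_eq_true d (G.ver a) he fun w hw hwa hwa' =>
    hv w (G.boundarySetoid.trans (Relation.EqvGen.rel _ _ (Or.inl rfl)) hw)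
      (by rwa [G.ver_ver] at hwa') hwa
  rw [G.ver_ver] at h2
  cases h3 : d a <;> cases h4 : d (G.ver a) <;> simp_all

/-- If a function flips along one edge line segment pair, it flips along the whole edge. -/
theorem ne_apply_com_of_mem_edgeOf (G : RibbonGraph.{u}) {d : G.Flag → Bool} {y w : G.Flag}
    (he : ∀ w, d (G.edg w) = d w) (hy : d y ≠ d (G.com y)) (hw : w ∈ G.edgeOf y) :
    d w ≠ d (G.com w) := by
  simp only [edgeOf, Set.mem_insert_iff, Set.mem_singleton_iff] at hw
  rcases hw with rfl | rfl | rfl | rfl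
  · exact hy
  · rw [G.com_com]
    exact hy.symm
  · rwa [G.com_edg, he, he]
  · rw [G.com_com, G.com_edg, he, he]
    exact hy.symm

theorem BoundaryInvariant.apply_eq {G : RibbonGraph.{u}} {c : G.Flag → Bool}
    (hc : G.BoundaryInvariant c) {p q : G.Flag} (h : G.boundarySetoid p q) : c p = c q := by
  induction h with
  | rel p q h => rcases h with rfl | rfl <;> simp [hc.1, hc.2]
  | refl => rfl
  | symm _ _ _ ih => exact ih.symm
  | trans _ _ _ _ _ ih ih' => exact ih.trans ih'

/-- The edges at `y` and `ver y` separate the same two boundary components, so one of them can be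
contracted. -/
theorem CheckerboardColourable.of_contract {G : RibbonGraph.{u}} {y : G.Flag}
    (hy : G.ver y ∉ G.edgeOf y) (hb : G.boundarySetoid (G.com y) (G.com (G.ver y)))
    (h : (G.contract y).CheckerboardColourable) : G.CheckerboardColourable := by
  obtain ⟨c, hc, hcom⟩ := (checkerboardColourable_contract_iff G y).1 h
  refine (checkerboardColourable_iff G).2 ⟨c, hc, fun w => ?_⟩
  by_cases hw : w ∈ G.edgeOf y
  · refine G.ne_apply_com_of_mem_edgeOf hc.2 ?_ hw
    -- Properness at the edge of `ver y` carries over: its two sides lie on the same boundary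
    -- components as those of the edge of `y`.
    have := hcom _ hy
    rwa [hc.1, ← hc.apply_eq hb] at this
  · exact hcom w hw

/-- The flag of the split ribbon graph given by a flag of the original one. -/
def evenSplitFlag (G : RibbonGraph.{u}) (a b : G.Flag) (hab : b ≠ a)
    (hab' : b ≠ G.ver a) (h : G.EvenArc a b) (w : G.Flag) :
    (G.evenSplit a b hab hab' h).Flag :=
  ⟨Sum.inl w, fun hw => by
    obtain ⟨p, hp⟩ : Sum.inl w ∈ Set.range Sum.inr :=
      edgeOf_insertEdge G a b hab hab' ▸ edgeOf_partialDual (G.insertEdge a b hab hab') _ ▸ hw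
    cases hp⟩

theorem com_evenSplitFlag (G : RibbonGraph.{u}) (a b : G.Flag) (hab : b ≠ a)
    (hab' : b ≠ G.ver a) (h : G.EvenArc a b) (w : G.Flag) :
    (G.evenSplit a b hab hab' h).com (G.evenSplitFlag a b hab hab' h w) =
      G.evenSplitFlag a b hab hab' h (G.com w) :=
  Subtype.ext (com_contract _ _ _)

theorem edg_evenSplitFlag (G : RibbonGraph.{u}) (a b : G.Flag) (hab : b ≠ a)
    (hab' : b ≠ G.ver a) (h : G.EvenArc a b) (w : G.Flag) :
    (G.evenSplit a b hab hab' h).edg (G.evenSplitFlag a b hab hab' h w) =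
      G.evenSplitFlag a b hab hab' h (G.edg w) := by
  refine Subtype.ext (if_neg ?_)
  rw [edgeOf_insertEdge]
  rintro ⟨p, hp⟩
  cases hp

theorem mem_edgeOf_evenSplitFlag (G : RibbonGraph.{u}) (a b : G.Flag) (hab : b ≠ a)
    (hab' : b ≠ G.ver a) (h : G.EvenArc a b) {w y : G.Flag}
    (hw : G.evenSplitFlag a b hab hab' h w ∈
      (G.evenSplit a b hab hab' h).edgeOf (G.evenSplitFlag a b hab hab' h y)) :
    w ∈ G.edgeOf y := by
  simp only [edgeOf, com_evenSplitFlag, edg_evenSplitFlag, Set.mem_insert_iff,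
    Set.mem_singleton_iff] at hw ⊢
  have inj : ∀ p q, G.evenSplitFlag a b hab hab' h p = G.evenSplitFlag a b hab hab' h q →
      p = q := fun p q hpq => Sum.inl_injective (congrArg Subtype.val hpq)
  exact hw.imp (inj _ _) (Or.imp (inj _ _) (Or.imp (inj _ _) (inj _ _)))

/-- A function that is constant along the boundary components of the split ribbon graph. -/
theorem BoundaryInvariant.of_evenSplit {G : RibbonGraph.{u}} {a b : G.Flag} {hab : b ≠ a}
    {hab' : b ≠ G.ver a} {h : G.EvenArc a b} {c : (G.evenSplit a b hab hab' h).Flag → Bool}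
    (hc : (G.evenSplit a b hab hab' h).BoundaryInvariant c) :
    ∃ d : G.Flag → Bool, (∀ w, d w = c (G.evenSplitFlag a b hab hab' h w)) ∧
      (∀ w, d (G.edg w) = d w) ∧
      (∀ w, w ≠ a → w ≠ G.ver a → w ≠ b → w ≠ G.ver b → d (G.ver w) = d w) ∧
      d a = d (G.ver b) ∧ d (G.ver a) = d b := by
  obtain ⟨d, ⟨hv, he⟩, hd⟩ := hc.exists_extend_contract
  have e1 := hv (Sum.inr (false, false))
  have e2 := hv (Sum.inr (false, true))
  have e3 := hv (Sum.inr (true, false))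
  have e4 := hv (Sum.inr (true, true))
  have e5 := he (Sum.inr (false, false))
  have e6 := he (Sum.inr (false, true))
  simp only [insertEdge, Sum.elim_inr, Sum.map_inr, Bool.not_false, Bool.not_true, if_true,
    Bool.false_eq_true, if_false] at e1 e2 e3 e4 e5 e6
  refine ⟨fun w => d (Sum.inl w), fun w => hd (G.evenSplitFlag a b hab hab' h w),
    fun w => he (Sum.inl w), fun w h1 h2 h3 h4 => ?_, ?_, ?_⟩
  · have := hv (Sum.inl w)
    simpa only [insertEdge, Sum.elim_inl, if_neg h1, if_neg h2, if_neg h3, if_neg h4] using this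
  -- The sides of the new edge reconnect the boundary, leading from `a` to `ver b` and from `ver a`
  -- to `b`.
  · exact e2.trans (e6.symm.trans e3.symm)
  · exact e1.trans (e5.symm.trans e4.symm)

/-- A period of 1 or 2 would make two turns return to `a`, so 2 is below the minimal period. -/
theorem evenArc_turn_turn (G : RibbonGraph.{u}) {a : G.Flag} (h : G.turn (G.turn a) ≠ a) :
    G.EvenArc a (G.turn (G.turn a)) := by
  have := G.finite_flag
  have hinj : Function.Injective G.turn := G.ver_injective.comp G.com_injective
  have hpos : 0 < Function.minimalPeriod G.turn a :=
    Function.minimalPeriod_pos_of_mem_periodicPts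
      (Function.Injective.mem_periodicPts hinj a)
  refine ⟨2, ?_, even_two, rfl⟩
  have hp := Function.iterate_minimalPeriod (f := G.turn) (x := a)
  by_contra hlt
  have : Function.minimalPeriod G.turn a = 1 ∨ Function.minimalPeriod G.turn a = 2 := by omega
  rcases this with h1 | h1 <;> rw [h1] at hp
  · have hp' : G.turn a = a := hp
    exact h (by rw [hp', hp'])
  · exact h hp

/-- If the edges at `y` and `ver y` lead to different boundary components, an even splitting
merges these, and then one of the two edges can be contracted. -/
theorem CheckerboardColourable.of_contract_evenSplit {G : RibbonGraph.{u}} {y a b : G.Flag}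
    {hab : b ≠ a} {hab' : b ≠ G.ver a} {h : G.EvenArc a b} (ha : a = G.com y)
    (hb : b = G.ver (G.com (G.ver y)))
    (hy : G.ver y ∉ G.edgeOf y) (hn : ¬ G.boundarySetoid (G.com y) (G.com (G.ver y)))
    (hG : ((G.evenSplit a b hab hab' h).contract
      (G.evenSplitFlag a b hab hab' h y)).CheckerboardColourable) :
    G.CheckerboardColourable := by
  obtain ⟨c, hc, hcom⟩ := (checkerboardColourable_contract_iff _ _).1 hG
  obtain ⟨d, hdc, he, hv, hdab, hdab'⟩ := hc.of_evenSplit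
  have hcom' : ∀ w, w ∉ G.edgeOf y → d w ≠ d (G.com w) := by
    intro w hw
    rw [hdc, hdc, ← com_evenSplitFlag]
    exact hcom _ fun h' => hw (G.mem_edgeOf_evenSplitFlag a b hab hab' h h')
  have hvb : G.ver b = G.com (G.ver y) := by rw [hb, G.ver_ver]
  have hstep : ∀ w, G.boundarySetoid w (G.ver w) := fun w =>
    Relation.EqvGen.rel _ _ (Or.inl rfl)
  -- By `hn` the boundary component of `a` in `G` avoids the segment of `b`. The segment of `a` is
  -- then the only one on it where the colour could change, and the parity argument excludes this.
  have hva : d (G.ver a) = d a := by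
    refine G.apply_ver_eq d a he fun w hw h1 h2 => hv w h1 h2 ?_ ?_
    · rintro rfl
      refine hn ?_
      rw [← ha, ← hvb]
      exact G.boundarySetoid.trans hw (hstep _)
    · rintro rfl
      refine hn ?_
      rwa [← ha, ← hvb]
  have hver : ∀ w, d (G.ver w) = d w := by
    intro w
    by_cases h1 : w = a
    · rw [h1, hva]
    by_cases h2 : w = G.ver a
    · rw [h2, G.ver_ver, hva]
    by_cases h3 : w = b
    · rw [h3, ← hdab, ← hdab', hva]
    by_cases h4 : w = G.ver b
    · rw [h4, G.ver_ver, ← hdab, ← hdab', hva]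
    exact hv w h1 h2 h3 h4
  refine (checkerboardColourable_iff G).2 ⟨d, ⟨hver, he⟩, fun w => ?_⟩
  by_cases hw : w ∈ G.edgeOf y
  · refine G.ne_apply_com_of_mem_edgeOf he ?_ hw
    -- The far side `com (ver y) = ver b` of the second edge has the colour of `a = com y`, the far
    -- side of the first.
    have := hcom' _ hy
    rwa [hver, ← hvb, ← hdab, ha] at this
  · exact hcom' w hw

/-! ### Graphs in which every edge is a component -/

/-- If every vertex line segment is parallel to an edge line segment, every edge lies on two
boundary components of its own. -/
theorem checkerboardColourable_of_ver_eq_edg (G : RibbonGraph.{u})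
    (h : ∀ y, G.ver y = G.edg y) : G.CheckerboardColourable := by
  have := G.finite_flag
  obtain ⟨n, ⟨f⟩⟩ := Finite.exists_equiv_fin G.Flag
  -- Each edge line segment is labelled by the smaller index of its two ends. The two sides of an
  -- edge have distinct labels, and the colour records which label is smaller.
  let m : G.Flag → Fin n := fun y => min (f y) (f (G.edg y))
  have hm : ∀ y, m (G.edg y) = m y := fun y => by simp only [m, G.edg_edg, min_comm]
  have hne : ∀ y, m y ≠ m (G.com y) := by
    intro y hy
    have h1 := (G.com_ne y).symm
    have h2 : y ≠ G.edg (G.com y) := by rw [← G.com_edg]; exact (G.com_edg_ne y).symm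
    have h3 : G.edg y ≠ G.com y := fun h => G.com_edg_ne y (by rw [h, G.com_com])
    have h4 : G.edg y ≠ G.edg (G.com y) := by rw [← G.com_edg]; exact (G.com_ne _).symm
    simp only [m] at hy
    rcases min_choice (f y) (f (G.edg y)) with e | e <;>
      rcases min_choice (f (G.com y)) (f (G.edg (G.com y))) with e' | e' <;>
      rw [e, e', f.injective.eq_iff] at hy <;> contradiction
  refine (checkerboardColourable_iff G).2
    ⟨fun y => decide (m y < m (G.com y)), ⟨fun y => ?_, fun y => ?_⟩, fun y => ?_⟩
  · simp only [h, hm, G.com_edg]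
  · simp only [hm, G.com_edg]
  · simp only [G.com_com]
    rcases lt_or_gt_of_ne (hne y) with h' | h' <;> simp [h', h'.not_gt]

/-- Deleting all lone vertices. -/
theorem exists_minor_of_flag_equiv {B : RibbonGraph.{v}} (hB : IsEmpty B.Lone) :
    ∀ (n : ℕ) (G : RibbonGraph.{u}), Nat.card G.Lone = n →
      (∃ φ : G.Flag ≃ B.Flag, ∀ x, φ (G.com x) = B.com (φ x) ∧ φ (G.edg x) = B.edg (φ x) ∧
        φ (G.ver x) = B.ver (φ x)) →
      ∃ H : RibbonGraph.{u}, H.IsCheckerboardColourableMinor G ∧ H.Equivalent B := by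
  intro n
  induction n with
  | zero =>
    intro G hG hφ
    have := G.finite_lone
    have : IsEmpty G.Lone := Finite.card_eq_zero_iff.1 hG
    exact ⟨G, Relation.ReflTransGen.refl, hφ, ⟨Equiv.equivOfIsEmpty _ _⟩⟩
  | succ n ih =>
    intro G hG hφ
    have := G.finite_lone
    obtain ⟨i⟩ : Nonempty G.Lone := Finite.card_pos_iff.1 (by omega)
    have hcard : Nat.card (G.deleteLone i).Lone = n := by
      have h1 := Set.ncard_add_ncard_compl {i}
      rw [Set.ncard_singleton] at h1
      have h2 : Nat.card (G.deleteLone i).Lone = ({i}ᶜ : Set G.Lone).ncard := rfl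
      omega
    obtain ⟨H, hH, hHB⟩ := ih (G.deleteLone i) hcard hφ
    exact ⟨H, Relation.ReflTransGen.head (MinorStep.deleteLone G i) hH, hHB⟩

/-- The four corners of the edge containing `y`, indexed so that `com` changes the second
coordinate and `edg` changes both. -/
def corner (G : RibbonGraph.{u}) (y : G.Flag) (p : Bool × Bool) : G.Flag :=
  if p.1 then (if p.2 then G.edg y else G.com (G.edg y)) else (if p.2 then G.com y else y)

theorem corner_bijective (G : RibbonGraph.{u}) {y : G.Flag} (h : ∀ w, w ∈ G.edgeOf y) :
    Function.Bijective (G.corner y) := by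
  constructor
  · have h1 := G.com_ne y
    have h2 := G.edg_ne y
    have h3 := G.com_edg_ne y
    have h4 : G.edg y ≠ G.com y := fun h => G.com_edg_ne y (by rw [h, G.com_com])
    have h5 : G.com (G.edg y) ≠ G.com y := fun h => h2 (G.com_injective h)
    have h6 := G.com_ne (G.edg y)
    rintro ⟨i, j⟩ ⟨i', j'⟩
    cases i <;> cases j <;> cases i' <;> cases j' <;>
      simp [corner, h1, h2, h3, h4, h5, h6, h1.symm, h2.symm, h3.symm, h4.symm, h5.symm,
        h6.symm]
  · intro w
    have hw := h w
    simp only [edgeOf, Set.mem_insert_iff, Set.mem_singleton_iff] at hw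
    rcases hw with rfl | rfl | rfl | rfl
    · exact ⟨(false, false), rfl⟩
    · exact ⟨(false, true), rfl⟩
    · exact ⟨(true, true), rfl⟩
    · exact ⟨(true, false), rfl⟩

theorem exists_flag_equiv {G : RibbonGraph.{u}} {B : RibbonGraph.{v}} (f : B.Flag → G.Flag)
    (hf : Function.Bijective f) (hcom : ∀ p, f (B.com p) = G.com (f p))
    (hedg : ∀ p, f (B.edg p) = G.edg (f p)) (hver : ∀ p, f (B.ver p) = G.ver (f p)) :
    ∃ φ : G.Flag ≃ B.Flag, ∀ x, φ (G.com x) = B.com (φ x) ∧ φ (G.edg x) = B.edg (φ x) ∧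
      φ (G.ver x) = B.ver (φ x) := by
  let e := Equiv.ofBijective f hf
  have key : ∀ (g : G.Flag → G.Flag) (k : B.Flag → B.Flag), (∀ p, f (k p) = g (f p)) →
      ∀ x, e.symm (g x) = k (e.symm x) := fun g k hgk x => by
    rw [Equiv.symm_apply_eq]
    change _ = f _
    rw [hgk]
    exact congrArg g (e.apply_symm_apply x).symm
  exact ⟨e.symm, fun x => ⟨key _ _ hcom x, key _ _ hedg x, key _ _ hver x⟩⟩

/-- With only four flags, the value of the fixed-point-free involution `ver` at `y` determines it.
The two bad values give the two excluded graphs, up to lone vertices. -/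
theorem IsBad.exists_minor {G : RibbonGraph.{u}} {y : G.Flag} (hy : G.IsBad y)
    (h : ∀ w, w ∈ G.edgeOf y) :
    ∃ H : RibbonGraph.{u}, H.IsCheckerboardColourableMinor G ∧
      (H.Equivalent B₁.dual ∨ H.Equivalent Bbar₁) := by
  have hbij := G.corner_bijective h
  have hmem : G.ver (G.edg y) = y ∨ G.ver (G.edg y) = G.com y ∨ G.ver (G.edg y) = G.edg y ∨
    G.ver (G.edg y) = G.com (G.edg y) := h _
  have hne := G.ver_ne (G.edg y)
  have hflip : ∀ p q, G.ver p = q → G.ver q = p := fun p q hpq => by rw [← hpq, G.ver_ver]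
  have h4 : G.edg y ≠ G.com y := fun h => G.com_edg_ne y (by rw [h, G.com_com])
  rcases hy with hy | hy
  · have hy' : G.ver (G.edg y) = G.com (G.edg y) := by
      rcases hmem with e | e | e | e
      · exact absurd ((hflip _ _ e).symm.trans hy) h4
      · exact absurd (G.ver_injective (e.trans hy.symm)) (G.edg_ne y)
      · exact absurd e hne
      · exact e
    have hφ := exists_flag_equiv (G := G) (B := B₁.dual)
      -- In `B₁.dual` it is `com` that changes both coordinates and `edg` only the second, opposite
      -- to `corner`; the `xor` exchanges the conventions.
      (fun p : Bool × Bool => G.corner y (xor p.1 p.2, p.2))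
      (hbij.comp (g := G.corner y) (f := fun p : Bool × Bool => (xor p.1 p.2, p.2))
        ⟨by decide, by decide⟩)
      (by
        rintro ⟨i, j⟩
        cases i <;> cases j <;> simp [corner, B₁, dual, G.com_com])
      (by
        rintro ⟨i, j⟩
        cases i <;> cases j <;> simp [corner, B₁, dual, G.com_edg, G.edg_edg])
      (by
        rintro ⟨i, j⟩
        cases i <;> cases j <;> simp [corner, B₁, dual, hy, hy', hflip _ _ hy, hflip _ _ hy'])
    obtain ⟨H, hH, hHB⟩ :=
      exists_minor_of_flag_equiv (inferInstanceAs (IsEmpty Empty)) _ G rfl hφ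
    exact ⟨H, hH, Or.inl hHB⟩
  · have hy' : G.ver (G.edg y) = G.com y := by
      rcases hmem with e | e | e | e
      · exact absurd (hy.symm.trans (hflip _ _ e)) (G.com_ne _)
      · exact e
      · exact absurd e hne
      · exact absurd (G.ver_injective (e.trans hy.symm)) (G.edg_ne y)
    have hφ := exists_flag_equiv (G := G) (B := Bbar₁) (G.corner y) hbij
      (by
        rintro ⟨i, j⟩
        cases i <;> cases j <;> simp [corner, Bbar₁, G.com_com])
      (by
        rintro ⟨i, j⟩
        cases i <;> cases j <;> simp [corner, Bbar₁, G.com_edg, G.edg_edg])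
      (by
        rintro ⟨i, j⟩
        cases i <;> cases j <;> simp [corner, Bbar₁, hy, hy', hflip _ _ hy, hflip _ _ hy'])
    obtain ⟨H, hH, hHB⟩ :=
      exists_minor_of_flag_equiv (inferInstanceAs (IsEmpty Empty)) _ G rfl hφ
    exact ⟨H, hH, Or.inr hHB⟩

/-! ### The induction -/

theorem exists_minor_of_not_checkerboardColourable :
    ∀ (n : ℕ) (G : RibbonGraph.{u}), Nat.card G.Flag = n → ¬ G.CheckerboardColourable →
      ∃ H : RibbonGraph.{u}, H.IsCheckerboardColourableMinor G ∧
        (H.Equivalent B₁.dual ∨ H.Equivalent Bbar₁) := by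
  intro n
  induction n using Nat.strong_induction_on with
  | _ n ih =>
  intro G hn hG
  have ih_contract : ∀ x, ¬ (G.contract x).CheckerboardColourable →
      ∃ H : RibbonGraph.{u}, H.IsCheckerboardColourableMinor G ∧
        (H.Equivalent B₁.dual ∨ H.Equivalent Bbar₁) := by
    intro x hx
    have := G.card_contract x
    obtain ⟨H, hH, hHB⟩ := ih _ (by omega) _ rfl hx
    exact ⟨H, Relation.ReflTransGen.head (MinorStep.contract G x) hH, hHB⟩
  by_cases hcase : ∃ y, G.ver y ∉ G.edgeOf y
  · obtain ⟨y, hy⟩ := hcase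
    by_cases hb : G.boundarySetoid (G.com y) (G.com (G.ver y))
    · exact ih_contract y fun h => hG (h.of_contract hy hb)
    -- The splitting spans the two common line segments on either side of the vertex line segment
    -- from `y` to `ver y`, hence an arc of length 2.
    · have htt : G.turn (G.turn (G.com y)) = G.ver (G.com (G.ver y)) := by
        simp [turn, G.com_com]
      have hab : G.ver (G.com (G.ver y)) ≠ G.com y := by
        intro h
        rw [← h] at hb
        exact hb (G.boundarySetoid.symm (Relation.EqvGen.rel _ _ (Or.inl rfl)))
      have hab' : G.ver (G.com (G.ver y)) ≠ G.ver (G.com y) := fun h =>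
        G.ver_ne _ (G.com_injective (G.ver_injective h))
      have harc : G.EvenArc (G.com y) (G.ver (G.com (G.ver y))) := by
        rw [← htt] at hab ⊢
        exact G.evenArc_turn_turn hab
      have hcard := G.card_evenSplit _ _ hab hab' harc
      have hcard' := (G.evenSplit _ _ hab hab' harc).card_contract
        (G.evenSplitFlag _ _ hab hab' harc y)
      obtain ⟨H, hH, hHB⟩ := ih _ (by omega) _ rfl fun h =>
        hG (h.of_contract_evenSplit rfl rfl hy hb)
      exact ⟨H, Relation.ReflTransGen.head (MinorStep.evenSplit G _ _ hab hab' harc)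
        (Relation.ReflTransGen.head (MinorStep.contract _ _) hH), hHB⟩
  · push Not at hcase
    obtain ⟨y, hy⟩ : ∃ y, G.ver y ≠ G.edg y := by
      by_contra! h
      exact hG (G.checkerboardColourable_of_ver_eq_edg h)
    have hbad : G.IsBad y := by
      have := hcase y
      simp only [edgeOf, Set.mem_insert_iff, Set.mem_singleton_iff] at this
      rcases this with h | h | h | h
      · exact absurd h (G.ver_ne y)
      · exact Or.inl h
      · exact absurd h hy
      · exact Or.inr h
    by_cases hall : ∀ w, w ∈ G.edgeOf y
    · exact hbad.exists_minor hall
    · push Not at hall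
      obtain ⟨w, hw⟩ := hall
      -- The edge of `y` survives the contraction of another edge, and being bad at `y` still rules
      -- out a proper colouring there.
      refine ih_contract w fun h => ?_
      obtain ⟨c, hc, hcom⟩ := (checkerboardColourable_contract_iff G w).1 h
      exact hcom y (fun h' => hw (G.mem_edgeOf_comm h')) (hbad.apply_com hc).symm

end RibbonGraph

theorem mainTheorem2 (G : RibbonGraph.{u}) :
    G.CheckerboardColourable ↔
      ¬ ∃ H : RibbonGraph.{u}, H.IsCheckerboardColourableMinor G ∧
        (H.Equivalent RibbonGraph.B₁.dual ∨ H.Equivalent RibbonGraph.Bbar₁) := by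
  constructor
  · rintro hG ⟨H, hH, h | h⟩
    · exact RibbonGraph.not_checkerboardColourable_dual_B₁ ((hG.of_minor hH).of_equivalent h)
    · exact RibbonGraph.not_checkerboardColourable_Bbar₁ ((hG.of_minor hH).of_equivalent h)
  · intro h
    by_contra hG
    exact h (RibbonGraph.exists_minor_of_not_checkerboardColourable _ G rfl hG)
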